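/- Let $c\in(0,1)$ and $\beta>0$. For $f,g:\{0,1,2,\dots\}\to\mathbb R$ put $$\langle f,g\rangle_{c,\beta}=\sum_{k=0}^{\infty}\frac{(\beta)_k}{k!}\,c^k f(k)g(k),\qquad \|f\|_{c,\beta}=\langle f,f\rangle_{c,\beta}^{1/2},$$ where $(\beta)_0=1$ and $(\beta)_k=\beta(\beta+1)\cdots(\beta+k-1)$ for $k\ge 1$, and let $\Delta f(x)=f(x+1)-f(x)$. For an integer $n\ge 0$ let $\mathcal P_n$ be the set of real polynomials of degree at most $n$, and let $$\gamma_n(c,\beta)=\sup\{\|\Delta p\|_{c,\beta} : p\in\mathcal P_n,\ \|p\|_{c,\beta}=1\}.$$ The series defining $\langle p,q\rangle_{c,\beta}$ converges for all real polynomials $p,q$, and $\gamma_n(c,\beta)$ is finite and is the smallest constant $\gamma$ such that $\|\Delta p\|_{c,\beta}\le\gamma\,\|p\|_{c,\beta}$ for all $p\in\mathcal P_n$. Moreover: (i) For every $c\in(0,1)$ one has $\gamma_n(c,1)<1+\frac{1}{\sqrt c}$ for every $n\ge 0$, and $\lim_{n\to\infty}\gamma_n(c,1)=1+\frac1{\sqrt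 c}$. (ii) For every fixed $n\ge 1$ and $c\in(0,1)$, $\gamma_n(c,\beta)$ is a strictly decreasing function of $\beta\in(0,\infty)$. (iii) For every fixed $c\in(0,1)$ and $\beta>0$ there is a constant $C(c,\beta)>0$ such that $\gamma_n(c,\beta)\le C(c,\beta)$ for every $n\ge 0$. -/

import Mathlib

open Filter Topology

noncomputable section

/-- The Meixner weight `(β)_k / k! * c ^ k`, with `(β)_k = β (β + 1) ⋯ (β + k - 1)` the rising
factorial. -/
def meixnerWeight (c β : ℝ) (k : ℕ) : ℝ :=
  (ascPochhammer ℝ k).eval β / (k.factorial : ℝ) * c ^ k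

/-- The Meixner inner product of two real sequences. -/
def meixnerInner (c β : ℝ) (f g : ℕ → ℝ) : ℝ :=
  ∑' k : ℕ, meixnerWeight c β k * f k * g k

/-- The Meixner norm of a real sequence. -/
def meixnerNorm (c β : ℝ) (f : ℕ → ℝ) : ℝ :=
  Real.sqrt (meixnerInner c β f f)

/-- The values of a real polynomial at the points `0, 1, 2, …`. -/
def polySeq (p : Polynomial ℝ) (k : ℕ) : ℝ := p.eval (k : ℝ)

/-- The sharp constant `sup {‖Δ p‖ : deg p ≤ n, ‖p‖ = 1}`, where `fwdDiff 1` is the forward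
difference `Δ f (x) = f (x + 1) - f x`. -/
def markovConst (n : ℕ) (c β : ℝ) : ℝ :=
  sSup {r : ℝ | ∃ p : Polynomial ℝ, p.natDegree ≤ n ∧ meixnerNorm c β (polySeq p) = 1 ∧
    r = meixnerNorm c β (fwdDiff 1 (polySeq p))}

end

/-! In the basis of orthonormal Meixner polynomials, `Δ` becomes an explicit matrix. With the
normalization of `meixnerPoly`, `Δ M_m = -(c⁻¹ - 1) ∑_{k<m} M_k` (`polyDiff_meixnerPoly`), and
`‖M_m‖²` is `‖1‖²` times the weight with `c⁻¹` in place of `c`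
(`meixnerFunctional_meixnerPoly_mul`). Hence `γ_n` is the largest singular value of a strictly upper
triangular matrix whose nonzero entries share one sign, and it is attained at a nonnegative vector
(`exists_meixnerExpansion_eq`).

(ii) holds because every nonzero entry has strictly decreasing modulus in `β`
(`diffEntry_strictAnti`). (iii) holds because the shift `p ↦ p(· + 1)` is bounded in the weighted
norm. For (i), the shift at `β = 1` has norm at most `1/√c`, so `Δ` has norm at most `1 + 1/√c`, and
equality would force `p = 0` on the naturals. The matrix is then Toeplitz, and the all-ones vector
gives the matching lower bound in the limit. -/

open Polynomial

/-! ### The weight: recurrences and summability. -/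

section Weight

variable {c β : ℝ}

lemma meixnerWeight_zero (c β : ℝ) : meixnerWeight c β 0 = 1 := by
  simp [meixnerWeight]

lemma meixnerWeight_succ (c β : ℝ) (k : ℕ) :
    meixnerWeight c β (k + 1) = meixnerWeight c β k * (c * (β + k) / (k + 1)) := by
  have h : (k.factorial : ℝ) ≠ 0 := by positivity
  simp only [meixnerWeight, ascPochhammer_succ_eval, Nat.factorial_succ]
  push_cast
  field_simp
  ring

lemma meixnerWeight_pos (hc : 0 < c) (hβ : 0 < β) (k : ℕ) : 0 < meixnerWeight c β k := by
  have := ascPochhammer_pos k β hβ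
  unfold meixnerWeight
  positivity

lemma meixnerWeight_one (c : ℝ) (k : ℕ) : meixnerWeight c 1 k = c ^ k := by
  have h : (k.factorial : ℝ) ≠ 0 := by positivity
  simp [meixnerWeight, ascPochhammer_eval_one, h]

lemma mul_meixnerWeight_add_one (c β : ℝ) (k : ℕ) :
    β * meixnerWeight c (β + 1) k = (β + k) * meixnerWeight c β k := by
  induction k with
  | zero => simp [meixnerWeight_zero]
  | succ k ih =>
    rw [meixnerWeight_succ, meixnerWeight_succ, ← mul_assoc, ih]
    push_cast
    ring

lemma mul_meixnerWeight_add_one' (c β : ℝ) (k : ℕ) :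
    β * c * meixnerWeight c (β + 1) k = (k + 1) * meixnerWeight c β (k + 1) := by
  rw [mul_right_comm, mul_meixnerWeight_add_one, meixnerWeight_succ]
  field_simp

lemma summable_meixnerWeight_mul_pow (hc : 0 < c) (hc1 : c < 1) (hβ : 0 < β) (d : ℕ) :
    Summable fun k : ℕ => meixnerWeight c β k * ((k : ℝ) + 1) ^ d := by
  have hpos : ∀ k : ℕ, 0 < meixnerWeight c β k * ((k : ℝ) + 1) ^ d := fun k =>
    mul_pos (meixnerWeight_pos hc hβ k) (by positivity)
  refine summable_of_ratio_test_tendsto_lt_one hc1 (.of_forall fun k => (hpos k).ne') ?_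
  have hinv : Tendsto (fun k : ℕ => 1 / ((k : ℝ) + 1)) atTop (𝓝 0) :=
    tendsto_one_div_add_atTop_nhds_zero_nat
  have hlim : Tendsto (fun k : ℕ => c * (1 + (β - 1) * (1 / ((k : ℝ) + 1))) *
      (1 + 1 / ((k : ℝ) + 1)) ^ d) atTop (𝓝 (c * (1 + (β - 1) * 0) * (1 + 0) ^ d)) :=
    (((hinv.const_mul _).const_add _).const_mul _).mul ((hinv.const_add _).pow _)
  simp only [mul_zero, add_zero, mul_one, one_pow] at hlim
  refine hlim.congr fun k => ?_
  rw [Real.norm_of_nonneg (hpos _).le, Real.norm_of_nonneg (hpos _).le, meixnerWeight_succ]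
  have h1 : meixnerWeight c β k ≠ 0 := (meixnerWeight_pos hc hβ k).ne'
  have h2 : (k : ℝ) + 1 ≠ 0 := by positivity
  have h3 : (1 : ℝ) + 1 / (k + 1) = ((k + 1 : ℕ) + 1) / (k + 1) := by
    push_cast
    field_simp
  rw [h3, div_pow]
  field_simp
  ring

lemma summable_meixnerWeight_mul_eval (hc : 0 < c) (hc1 : c < 1) (hβ : 0 < β) (p : ℝ[X]) :
    Summable fun k : ℕ => meixnerWeight c β k * p.eval (k : ℝ) := by
  induction p using Polynomial.induction_on' with
  | add p q hp hq => simpa [mul_add] using hp.add hq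
  | monomial d a =>
    have h : Summable fun k : ℕ => meixnerWeight c β k * (k : ℝ) ^ d := by
      refine Summable.of_nonneg_of_le
        (fun k => mul_nonneg (meixnerWeight_pos hc hβ k).le (by positivity)) (fun k => ?_)
        (summable_meixnerWeight_mul_pow hc hc1 hβ d)
      have := (meixnerWeight_pos hc hβ k).le
      gcongr
      linarith
    refine (h.mul_left a).congr fun k => ?_
    simp only [eval_monomial]
    ring

end Weight

/-! ### The moment functional and the adjoint of the forward difference. -/

section Functional

variable {c β : ℝ} (hc : 0 < c) (hc1 : c < 1) (hβ : 0 < β)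

/-- Summation against the Meixner weight, as a linear functional on polynomials. -/
noncomputable def meixnerFunctional : ℝ[X] →ₗ[ℝ] ℝ where
  toFun p := ∑' k : ℕ, meixnerWeight c β k * p.eval (k : ℝ)
  map_add' p q := by
    rw [← (summable_meixnerWeight_mul_eval hc hc1 hβ p).tsum_add
      (summable_meixnerWeight_mul_eval hc hc1 hβ q)]
    simp [mul_add]
  map_smul' a p := by
    rw [RingHom.id_apply, smul_eq_mul, ← tsum_mul_left]
    simp [mul_left_comm]

lemma meixnerFunctional_apply (p : ℝ[X]) :
    meixnerFunctional hc hc1 hβ p = ∑' k : ℕ, meixnerWeight c β k * p.eval (k : ℝ) := rfl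

lemma meixnerInner_polySeq (p q : ℝ[X]) :
    meixnerInner c β (polySeq p) (polySeq q) = meixnerFunctional hc hc1 hβ (p * q) := by
  simp [meixnerInner, meixnerFunctional_apply, polySeq, mul_assoc]

lemma meixnerFunctional_mul_self_nonneg (p : ℝ[X]) :
    0 ≤ meixnerFunctional hc hc1 hβ (p * p) := by
  refine tsum_nonneg fun k => mul_nonneg (meixnerWeight_pos hc hβ k).le ?_
  rw [eval_mul]
  exact mul_self_nonneg _

lemma meixnerNorm_polySeq_sq (p : ℝ[X]) :
    meixnerNorm c β (polySeq p) ^ 2 = meixnerFunctional hc hc1 hβ (p * p) := by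
  rw [meixnerNorm, meixnerInner_polySeq hc hc1 hβ,
    Real.sq_sqrt (meixnerFunctional_mul_self_nonneg hc hc1 hβ p)]

lemma meixnerFunctional_one_pos : 0 < meixnerFunctional hc hc1 hβ 1 := by
  refine (summable_meixnerWeight_mul_eval hc hc1 hβ 1).tsum_pos (fun k => ?_) 0 ?_
  · simpa using (meixnerWeight_pos hc hβ k).le
  · simp [meixnerWeight_zero]

/-- The forward difference of a polynomial. -/
noncomputable def polyDiff : ℝ[X] →ₗ[ℝ] ℝ[X] where
  toFun p := p.comp (X + 1) - p
  map_add' p q := by simp only [add_comp]; ring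
  map_smul' a p := by simp [smul_sub]

lemma polyDiff_apply (p : ℝ[X]) : polyDiff p = p.comp (X + 1) - p := rfl

lemma fwdDiff_polySeq (p : ℝ[X]) : fwdDiff 1 (polySeq p) = polySeq (polyDiff p) := by
  ext k
  simp [fwdDiff, polySeq, polyDiff_apply]

/-- The raising operator `f ↦ x f(x - 1) / c - (β + x) f(x)`, adjoint to the forward
difference up to a shift of `β`. -/
noncomputable def meixnerRaise (c β : ℝ) (f : ℝ[X]) : ℝ[X] :=
  C c⁻¹ * X * f.comp (X - 1) - (C β + X) * f

lemma meixnerFunctional_mul_meixnerRaise (f g : ℝ[X]) :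
    meixnerFunctional hc hc1 hβ (g * meixnerRaise c β f) =
      β * meixnerFunctional hc hc1 (by linarith : 0 < β + 1) (polyDiff g * f) := by
  have hβ' : 0 < β + 1 := by linarith
  have h1 : meixnerFunctional hc hc1 hβ (g * (C c⁻¹ * X * f.comp (X - 1))) =
      β * meixnerFunctional hc hc1 hβ' (g.comp (X + 1) * f) := by
    simp only [meixnerFunctional_apply]
    -- The factor `X` kills the term at `0`, so the sum can be reindexed by `k + 1`.
    rw [(summable_meixnerWeight_mul_eval hc hc1 hβ _).tsum_eq_zero_add, ← tsum_mul_left]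
    simp only [eval_mul, eval_C, eval_X, eval_comp, eval_sub, eval_one, eval_add,
      Nat.cast_zero, mul_zero, zero_mul, zero_add, Nat.cast_add, Nat.cast_one,
      add_sub_cancel_right]
    refine tsum_congr fun k => ?_
    have := mul_meixnerWeight_add_one' c β k
    have h2 : β * meixnerWeight c (β + 1) k = c⁻¹ * ((k + 1) * meixnerWeight c β (k + 1)) := by
      rw [← this]; field_simp
    linear_combination -(eval ((k : ℝ) + 1) g * eval (k : ℝ) f) * h2
  have h2 : meixnerFunctional hc hc1 hβ (g * ((C β + X) * f)) =
      β * meixnerFunctional hc hc1 hβ' (g * f) := by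
    simp only [meixnerFunctional_apply]
    rw [← tsum_mul_left]
    refine tsum_congr fun k => ?_
    simp only [eval_mul, eval_C, eval_X, eval_add]
    linear_combination
      -(eval (k : ℝ) g * eval (k : ℝ) f) * mul_meixnerWeight_add_one c β k
  rw [meixnerRaise, mul_sub, map_sub, h1, h2, polyDiff_apply, sub_mul, map_sub]
  ring

/-- Summing the weight relation expresses the left side through the first moment. Adjointness with
`f = g = 1` gives that moment: `(c⁻¹ - 1) L(X) = β L(1)`. No closed form of the binomial series is
needed. -/
lemma meixnerFunctional_add_one_one :
    meixnerFunctional hc hc1 (by linarith : 0 < β + 1) 1 =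
      meixnerFunctional hc hc1 hβ 1 / (1 - c) := by
  have hβ' : 0 < β + 1 := by linarith
  have h1 : β * meixnerFunctional hc hc1 hβ' 1 =
      β * meixnerFunctional hc hc1 hβ 1 + meixnerFunctional hc hc1 hβ X := by
    rw [← smul_eq_mul β (meixnerFunctional hc hc1 hβ 1), ← map_smul, ← map_add]
    simp only [meixnerFunctional_apply]
    rw [← tsum_mul_left]
    refine tsum_congr fun k => ?_
    rw [← mul_assoc, mul_meixnerWeight_add_one]
    simp
    ring
  have h2 := meixnerFunctional_mul_meixnerRaise hc hc1 hβ 1 1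
  have h3 : (1 : ℝ[X]) * meixnerRaise c β 1 = (c⁻¹ - 1) • X - β • 1 := by
    simp only [meixnerRaise, one_comp, smul_eq_C_mul, C_sub, C_1]
    ring
  have h4 : polyDiff 1 * (1 : ℝ[X]) = 0 := by simp [polyDiff_apply]
  rw [h3, h4, map_zero, mul_zero, map_sub, map_smul, map_smul, smul_eq_mul, smul_eq_mul] at h2
  have hc' : 1 - c ≠ 0 := by linarith
  rw [eq_div_iff hc']
  field_simp at h2
  apply mul_left_cancel₀ hβ.ne'
  linear_combination (1 - c) * h1 + h2

end Functional

/-! ### Meixner polynomials: difference formula, orthogonality, spanning. -/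

section Polynomials

/-- The Meixner polynomials, normalized so that their forward differences are
`-(c⁻¹ - 1)` times the partial sums of the sequence. -/
noncomputable def meixnerPoly (c : ℝ) : ℕ → ℝ → ℝ[X]
  | 0, _ => 1
  | n + 1, β => (-((n : ℝ) + 1)⁻¹) • meixnerRaise c β (meixnerPoly c n (β + 1))

variable {c : ℝ}

lemma meixnerRaise_smul (c β a : ℝ) (f : ℝ[X]) :
    meixnerRaise c β (a • f) = a • meixnerRaise c β f := by
  simp only [meixnerRaise, smul_eq_C_mul, mul_comp, C_comp]
  ring

lemma meixnerRaise_sub (c β : ℝ) (f g : ℝ[X]) :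
    meixnerRaise c β (f - g) = meixnerRaise c β f - meixnerRaise c β g := by
  simp only [meixnerRaise, sub_comp]
  ring

/-- This commutation relation drives the induction that computes `Δ M_{n+1}`. -/
lemma polyDiff_meixnerRaise (c β : ℝ) (f : ℝ[X]) :
    polyDiff (meixnerRaise c β f) =
      meixnerRaise c (β + 1) (polyDiff f) + (c⁻¹ - 1) • f := by
  have h1 : (f.comp (X - 1)).comp (X + 1) = f := by simp [comp_assoc]
  have h2 : (f.comp (X + 1)).comp (X - 1) = f := by simp [comp_assoc]
  simp only [polyDiff_apply, meixnerRaise, sub_comp, mul_comp, add_comp, C_comp, X_comp, h1, h2,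
    smul_eq_C_mul, C_sub, C_1, C_add]
  ring

lemma meixnerRaise_meixnerPoly (c β : ℝ) (n : ℕ) :
    meixnerRaise c β (meixnerPoly c n (β + 1)) =
      (-((n : ℝ) + 1)) • meixnerPoly c (n + 1) β := by
  have : (n : ℝ) + 1 ≠ 0 := by positivity
  rw [meixnerPoly, smul_smul, neg_mul_neg, mul_inv_cancel₀ this, one_smul]

lemma polyDiff_meixnerPoly_succ (c β : ℝ) (n : ℕ) :
    polyDiff (meixnerPoly c (n + 1) β) = (-(c⁻¹ - 1)) • meixnerPoly c n (β + 1) := by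
  induction n generalizing β with
  | zero =>
    simp only [meixnerPoly, map_smul, polyDiff_meixnerRaise]
    simp [polyDiff_apply, meixnerRaise]
    rw [← neg_smul, neg_sub]
  | succ n ih =>
    have h : ((n + 1 : ℕ) : ℝ) + 1 ≠ 0 := by positivity
    rw [meixnerPoly, map_smul, polyDiff_meixnerRaise, ih, meixnerRaise_smul,
      meixnerRaise_meixnerPoly, smul_smul, ← add_smul, smul_smul]
    congr 1
    field_simp
    push_cast
    ring

lemma meixnerPoly_succ_eq_sub (c β : ℝ) (n : ℕ) :
    meixnerPoly c (n + 1) β = meixnerPoly c (n + 1) (β + 1) - meixnerPoly c n (β + 1) := by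
  have key : ∀ β f, meixnerRaise c β f = meixnerRaise c (β + 1) f + f := fun β f => by
    simp only [meixnerRaise, C_add, C_1]
    ring
  induction n generalizing β with
  | zero =>
    simp only [meixnerPoly, key β]
    simp
    ring
  | succ n ih =>
    have h : ((n + 1 : ℕ) : ℝ) + 1 ≠ 0 := by positivity
    rw [meixnerPoly, key β]
    nth_rw 1 [ih]
    rw [meixnerRaise_sub, meixnerRaise_meixnerPoly, meixnerRaise_meixnerPoly, smul_add, smul_sub,
      smul_smul, smul_smul, neg_mul_neg, inv_mul_cancel₀ h, one_smul, neg_mul_neg, sub_add,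
      ← sub_smul]
    congr 1
    nth_rw 2 [← one_smul ℝ (meixnerPoly c (n + 1) (β + 1))]
    congr 1
    field_simp
    push_cast
    ring

lemma polyDiff_meixnerPoly (c β : ℝ) (n : ℕ) :
    polyDiff (meixnerPoly c n β) =
      (-(c⁻¹ - 1)) • ∑ k ∈ Finset.range n, meixnerPoly c k β := by
  induction n with
  | zero => simp [meixnerPoly, polyDiff_apply]
  | succ n ih =>
    -- The two identities are purely algebraic, so `β - 1` may be nonpositive. Together they give `Δ
    -- M_{n+1} - Δ M_n = -(c⁻¹ - 1) M_n` at parameter `β`, which telescopes.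
    have h1 := meixnerPoly_succ_eq_sub c (β - 1) n
    have h2 := polyDiff_meixnerPoly_succ c (β - 1) n
    rw [sub_add_cancel] at h1 h2
    rw [h1, map_sub, ih, sub_eq_iff_eq_add, ← smul_add] at h2
    rw [h2, Finset.sum_range_succ, add_comm]

variable {β : ℝ}

lemma meixnerFunctional_meixnerPoly_zero_mul_succ (hc : 0 < c) (hc1 : c < 1) (hβ : 0 < β)
    (n : ℕ) :
    meixnerFunctional hc hc1 hβ (meixnerPoly c 0 β * meixnerPoly c (n + 1) β) = 0 := by
  rw [meixnerPoly, meixnerPoly, mul_smul_comm, map_smul, meixnerFunctional_mul_meixnerRaise]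
  simp [polyDiff_apply]

/-- Adjointness moves the raising operator onto the other factor as `Δ`, which lowers both degrees
and replaces `β` by `β + 1`. -/
lemma meixnerFunctional_meixnerPoly_mul (hc : 0 < c) (hc1 : c < 1) (hβ : 0 < β) (m n : ℕ) :
    meixnerFunctional hc hc1 hβ (meixnerPoly c m β * meixnerPoly c n β) =
      if m = n then meixnerWeight c⁻¹ β n * meixnerFunctional hc hc1 hβ 1 else 0 := by
  induction n generalizing m β with
  | zero =>
    cases m with
    | zero => simp [meixnerPoly, meixnerWeight_zero]
    | succ m => rw [mul_comm, meixnerFunctional_meixnerPoly_zero_mul_succ]; simp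
  | succ n ih =>
    cases m with
    | zero => rw [meixnerFunctional_meixnerPoly_zero_mul_succ]; simp
    | succ m =>
      have hβ' : 0 < β + 1 := by linarith
      rw [meixnerPoly.eq_2 c β n, mul_smul_comm, map_smul, meixnerFunctional_mul_meixnerRaise,
        polyDiff_meixnerPoly_succ, smul_mul_assoc, map_smul, ih hβ']
      simp only [add_left_inj]
      split_ifs with h
      · have h1 := mul_meixnerWeight_add_one' c⁻¹ β n
        have h2 : (n : ℝ) + 1 ≠ 0 := by positivity
        have h3 : meixnerWeight c⁻¹ β (n + 1) =
            β * c⁻¹ * meixnerWeight c⁻¹ (β + 1) n / (n + 1) := by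
          rw [h1]; field_simp
        have h4 : 1 - c ≠ 0 := by linarith
        rw [h3, meixnerFunctional_add_one_one hc hc1 hβ]
        simp only [smul_eq_mul]
        field_simp
      · simp

lemma natDegree_meixnerPoly_le (c β : ℝ) (n : ℕ) : (meixnerPoly c n β).natDegree ≤ n := by
  induction n generalizing β with
  | zero => simp [meixnerPoly]
  | succ n ih =>
    rw [meixnerPoly]
    refine (natDegree_smul_le _ _).trans ?_
    rw [meixnerRaise]
    have h := ih (β + 1)
    refine (natDegree_sub_le _ _).trans (max_le ?_ ?_)
    · have h1 : ((meixnerPoly c n (β + 1)).comp (X - 1)).natDegree ≤ n := by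
        rw [natDegree_comp, ← C_1, natDegree_X_sub_C, mul_one]; exact h
      rw [mul_assoc]
      refine (natDegree_C_mul_le _ _).trans (natDegree_mul_le.trans ?_)
      rw [natDegree_X]; omega
    · refine natDegree_mul_le.trans ?_
      have : (C β + X : ℝ[X]).natDegree = 1 := by rw [add_comm]; exact natDegree_X_add_C β
      omega

/-- Each raising step multiplies the top coefficient by `-(c⁻¹ - 1) / (n + 1)`. -/
lemma coeff_meixnerPoly_ne_zero (hc : 0 < c) (hc1 : c < 1) (β : ℝ) (n : ℕ) :
    (meixnerPoly c n β).coeff n ≠ 0 := by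
  induction n generalizing β with
  | zero => simp [meixnerPoly]
  | succ n ih =>
    have hdeg := natDegree_meixnerPoly_le c (β + 1) n
    set f := meixnerPoly c n (β + 1) with hf
    have h1 : (f.comp (X - 1)).coeff n = f.coeff n := by
      have hn : f.natDegree = n := natDegree_eq_of_le_of_coeff_ne_zero hdeg (ih _)
      have h := coeff_comp_degree_mul_degree (p := f) (q := (X - C 1 : ℝ[X]))
        (by rw [natDegree_X_sub_C]; exact one_ne_zero)
      rw [natDegree_X_sub_C, mul_one, (monic_X_sub_C (1 : ℝ)).leadingCoeff, one_pow, mul_one,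
        leadingCoeff, hn, C_1] at h
      exact h
    have h2 : f.coeff (n + 1) = 0 := coeff_eq_zero_of_natDegree_lt (by omega)
    have h3 : 0 < c⁻¹ - 1 := sub_pos.2 ((one_lt_inv₀ hc).2 hc1)
    have h4 : (n : ℝ) + 1 ≠ 0 := by positivity
    rw [meixnerPoly, ← hf, coeff_smul, meixnerRaise, coeff_sub, mul_assoc, coeff_C_mul,
      coeff_X_mul, h1, add_mul, coeff_add, coeff_C_mul, coeff_X_mul, h2, mul_zero, zero_add,
      ← sub_one_mul, smul_eq_mul]
    exact mul_ne_zero (neg_ne_zero.2 (inv_ne_zero h4)) (mul_ne_zero h3.ne' (ih _))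

lemma exists_eq_sum_meixnerPoly (hc : 0 < c) (hc1 : c < 1) (β : ℝ) (n : ℕ) (p : ℝ[X])
    (hp : p.natDegree ≤ n) :
    ∃ a : ℕ → ℝ, p = ∑ k ∈ Finset.range (n + 1), a k • meixnerPoly c k β := by
  induction n generalizing p with
  | zero =>
    refine ⟨fun _ => p.coeff 0, ?_⟩
    rw [eq_C_of_natDegree_le_zero hp]
    simp [meixnerPoly, smul_eq_C_mul]
  | succ n ih =>
    have hQ := coeff_meixnerPoly_ne_zero hc hc1 β (n + 1)
    set t := p.coeff (n + 1) / (meixnerPoly c (n + 1) β).coeff (n + 1) with ht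
    have hdeg : (p - t • meixnerPoly c (n + 1) β).natDegree ≤ n + 1 :=
      (natDegree_sub_le _ _).trans
        (max_le hp ((natDegree_smul_le _ _).trans (natDegree_meixnerPoly_le c β _)))
    have hcoeff : (p - t • meixnerPoly c (n + 1) β).coeff (n + 1) = 0 := by
      rw [coeff_sub, coeff_smul, ht, smul_eq_mul, div_mul_cancel₀ _ hQ, sub_self]
    have hlt : (p - t • meixnerPoly c (n + 1) β).natDegree ≤ n := by
      rw [natDegree_le_iff_coeff_eq_zero]
      intro N hN
      rcases Nat.eq_or_lt_of_le (Nat.succ_le_of_lt hN) with h | h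
      · rw [← h]; exact hcoeff
      · exact coeff_eq_zero_of_natDegree_lt (by omega)
    obtain ⟨a, ha⟩ := ih _ hlt
    refine ⟨Function.update a (n + 1) t, ?_⟩
    rw [Finset.sum_range_succ, Function.update_self, ← sub_eq_iff_eq_add, ha]
    refine Finset.sum_congr rfl fun k hk => ?_
    rw [Function.update_of_ne (Finset.mem_range.1 hk).ne]

end Polynomials

lemma meixnerNorm_nonneg (c β : ℝ) (f : ℕ → ℝ) : 0 ≤ meixnerNorm c β f :=
  Real.sqrt_nonneg _

/-! ### The matrix of the forward difference and its quadratic form. -/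

section Matrix

variable {c β : ℝ}

lemma inv_sub_one_pos (hc : 0 < c) (hc1 : c < 1) : 0 < c⁻¹ - 1 :=
  sub_pos.2 ((one_lt_inv₀ hc).2 hc1)

/-- The entries, up to sign, of the matrix of the forward difference in the basis of
orthonormal Meixner polynomials. -/
noncomputable def diffEntry (c β : ℝ) (k m : ℕ) : ℝ :=
  if k < m then (c⁻¹ - 1) * √(meixnerWeight c⁻¹ β k / meixnerWeight c⁻¹ β m) else 0

lemma diffEntry_of_lt {k m : ℕ} (h : k < m) :
    diffEntry c β k m = (c⁻¹ - 1) * √(meixnerWeight c⁻¹ β k / meixnerWeight c⁻¹ β m) :=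
  if_pos h

lemma diffEntry_of_not_lt {k m : ℕ} (h : ¬ k < m) : diffEntry c β k m = 0 :=
  if_neg h

lemma diffEntry_nonneg (hc : 0 < c) (hc1 : c < 1) (k m : ℕ) : 0 ≤ diffEntry c β k m := by
  rw [diffEntry]
  split_ifs
  · exact mul_nonneg (inv_sub_one_pos hc hc1).le (Real.sqrt_nonneg _)
  · exact le_rfl

lemma diffEntry_pos (hc : 0 < c) (hc1 : c < 1) (hβ : 0 < β) {k m : ℕ} (h : k < m) :
    0 < diffEntry c β k m := by
  have hc' : 0 < c⁻¹ := inv_pos.2 hc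
  rw [diffEntry_of_lt h]
  exact mul_pos (inv_sub_one_pos hc hc1)
    (Real.sqrt_pos.2 (div_pos (meixnerWeight_pos hc' hβ k) (meixnerWeight_pos hc' hβ m)))

/-- The ratio of the `β₂`-weight to the `β₁`-weight increases with the index, since the step factor
`d (β + j) / (j + 1)` increases with `β`. -/
lemma meixnerWeight_mul_lt {d β₁ β₂ : ℝ} (hd : 0 < d) (h₁ : 0 < β₁) (h₁₂ : β₁ < β₂) {k m : ℕ}
    (hkm : k < m) :
    meixnerWeight d β₂ k * meixnerWeight d β₁ m < meixnerWeight d β₁ k * meixnerWeight d β₂ m := by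
  have h₂ : 0 < β₂ := h₁.trans h₁₂
  have hstep : ∀ j : ℕ, d * (β₁ + j) / (j + 1) < d * (β₂ + j) / (j + 1) := fun j => by gcongr
  have hpos : ∀ j : ℕ, 0 < d * (β₁ + j) / (j + 1) := fun j => by positivity
  have w₁ := meixnerWeight_pos hd h₁
  have w₂ := meixnerWeight_pos hd h₂
  induction m, Nat.succ_le_of_lt hkm using Nat.le_induction with
  | base =>
    rw [meixnerWeight_succ, meixnerWeight_succ]
    have := mul_lt_mul_of_pos_left (hstep k) (mul_pos (w₁ k) (w₂ k))
    linarith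
  | succ m hm ih =>
    rw [meixnerWeight_succ, meixnerWeight_succ, ← mul_assoc, ← mul_assoc]
    exact mul_lt_mul'' (ih hm) (hstep m) (mul_pos (w₂ k) (w₁ m)).le (hpos m).le

lemma diffEntry_strictAnti (hc : 0 < c) (hc1 : c < 1) {β₁ β₂ : ℝ} (h₁ : 0 < β₁) (h₁₂ : β₁ < β₂)
    {k m : ℕ} (h : k < m) : diffEntry c β₂ k m < diffEntry c β₁ k m := by
  have hc' : 0 < c⁻¹ := inv_pos.2 hc
  have h₂ : 0 < β₂ := h₁.trans h₁₂
  rw [diffEntry_of_lt h, diffEntry_of_lt h]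
  refine mul_lt_mul_of_pos_left (Real.sqrt_lt_sqrt ?_ ?_) (inv_sub_one_pos hc hc1)
  · exact (div_pos (meixnerWeight_pos hc' h₂ k) (meixnerWeight_pos hc' h₂ m)).le
  · rw [div_lt_div_iff₀ (meixnerWeight_pos hc' h₂ m) (meixnerWeight_pos hc' h₁ m)]
    exact meixnerWeight_mul_lt hc' h₁ h₁₂ h

lemma diffEntry_anti (hc : 0 < c) (hc1 : c < 1) {β₁ β₂ : ℝ} (h₁ : 0 < β₁) (h₁₂ : β₁ < β₂)
    (k m : ℕ) : diffEntry c β₂ k m ≤ diffEntry c β₁ k m := by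
  by_cases h : k < m
  · exact (diffEntry_strictAnti hc hc1 h₁ h₁₂ h).le
  · rw [diffEntry_of_not_lt h, diffEntry_of_not_lt h]

/-- The quadratic form of `‖Δ p‖²` in the coefficients of `p` with respect to the orthonormal
Meixner polynomials. -/
noncomputable def diffForm (c β : ℝ) {n : ℕ} (b : Fin (n + 1) → ℝ) : ℝ :=
  ∑ k : Fin (n + 1), (∑ m : Fin (n + 1), diffEntry c β k m * b m) ^ 2

lemma diffForm_nonneg {n : ℕ} (b : Fin (n + 1) → ℝ) : 0 ≤ diffForm c β b :=
  Finset.sum_nonneg fun _ _ => sq_nonneg _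

lemma diffForm_smul {n : ℕ} (t : ℝ) (b : Fin (n + 1) → ℝ) :
    diffForm c β (t • b) = t ^ 2 * diffForm c β b := by
  simp only [diffForm, Pi.smul_apply, smul_eq_mul, Finset.mul_sum, ← mul_pow]
  refine Finset.sum_congr rfl fun k _ => ?_
  congr 1
  exact Finset.sum_congr rfl fun m _ => mul_left_comm _ _ _

lemma diffForm_le_diffForm_abs (hc : 0 < c) (hc1 : c < 1) {n : ℕ} (b : Fin (n + 1) → ℝ) :
    diffForm c β b ≤ diffForm c β fun k => |b k| := by
  refine Finset.sum_le_sum fun k _ => ?_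
  rw [← sq_abs]
  refine pow_le_pow_left₀ (abs_nonneg _) ((Finset.abs_sum_le_sum_abs _ _).trans_eq ?_) 2
  refine Finset.sum_congr rfl fun m _ => ?_
  rw [abs_mul, abs_of_nonneg (diffEntry_nonneg hc hc1 _ _)]

/-- A maximizer exists on the compact unit sphere. Since the entries are nonnegative, taking
absolute values of its coordinates does not decrease the form. -/
lemma exists_nonneg_forall_diffForm_le (hc : 0 < c) (hc1 : c < 1) (β : ℝ) (n : ℕ) :
    ∃ b : Fin (n + 1) → ℝ, (∀ k, 0 ≤ b k) ∧ ∑ k, b k ^ 2 = 1 ∧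
      ∀ a : Fin (n + 1) → ℝ, diffForm c β a ≤ diffForm c β b * ∑ k, a k ^ 2 := by
  have hcompact : IsCompact {b : Fin (n + 1) → ℝ | ∑ k, b k ^ 2 = 1} := by
    refine (isCompact_Icc (a := fun _ => (-1 : ℝ)) (b := fun _ => 1)).of_isClosed_subset
      (isClosed_eq (by fun_prop) continuous_const) fun b hb => ?_
    have h : ∀ k, |b k| ≤ 1 := fun k => by
      rw [← sq_le_one_iff_abs_le_one, ← Set.mem_ofPred.1 hb]
      exact Finset.single_le_sum (f := fun k => b k ^ 2) (fun _ _ => sq_nonneg _)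
        (Finset.mem_univ k)
    exact ⟨fun k => (abs_le.1 (h k)).1, fun k => (abs_le.1 (h k)).2⟩
  have hne : {b : Fin (n + 1) → ℝ | ∑ k, b k ^ 2 = 1}.Nonempty :=
    ⟨Pi.single 0 1, by simp [Pi.single_apply]⟩
  have hcont : Continuous fun b : Fin (n + 1) → ℝ => diffForm c β b := by
    unfold diffForm
    fun_prop
  obtain ⟨b, hb, hmax⟩ := hcompact.exists_isMaxOn hne hcont.continuousOn
  refine ⟨fun k => |b k|, fun k => abs_nonneg _, by simpa using hb, fun a => ?_⟩
  rcases (Finset.sum_nonneg fun k _ => sq_nonneg (a k)).eq_or_lt' with h0 | hpos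
  · have ha : a = 0 := by
      ext k
      exact pow_eq_zero_iff two_ne_zero |>.1
        ((Finset.sum_eq_zero_iff_of_nonneg fun k _ => sq_nonneg (a k)).1 h0 k (Finset.mem_univ k))
    simp [ha, diffForm]
  · set s := ∑ k, a k ^ 2
    have hs : (√s)⁻¹ ^ 2 * s = 1 := by
      rw [inv_pow, Real.sq_sqrt hpos.le, inv_mul_cancel₀ hpos.ne']
    have hmem : ∑ k, ((√s)⁻¹ • a) k ^ 2 = 1 := by
      simp only [Pi.smul_apply, smul_eq_mul, mul_pow, ← Finset.mul_sum]
      exact hs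
    have h1 : diffForm c β ((√s)⁻¹ • a) ≤ diffForm c β b := hmax hmem
    rw [diffForm_smul] at h1
    have h2 := mul_le_mul_of_nonneg_right (h1.trans (diffForm_le_diffForm_abs hc hc1 b)) hpos.le
    rwa [mul_right_comm, hs, one_mul] at h2

end Matrix

/-! ### Both norms in orthonormal coordinates. -/

section Expansion

variable {c β : ℝ}

lemma meixnerFunctional_sum_mul_self (hc : 0 < c) (hc1 : c < 1) (hβ : 0 < β) {n : ℕ}
    (a : Fin (n + 1) → ℝ) :
    meixnerFunctional hc hc1 hβ
        ((∑ k : Fin (n + 1), a k • meixnerPoly c k β) *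
          ∑ k : Fin (n + 1), a k • meixnerPoly c k β) =
      meixnerFunctional hc hc1 hβ 1 * ∑ k : Fin (n + 1), meixnerWeight c⁻¹ β k * a k ^ 2 := by
  simp only [Finset.sum_mul_sum, map_sum, smul_mul_smul_comm, map_smul,
    meixnerFunctional_meixnerPoly_mul, Fin.val_inj, smul_eq_mul, mul_ite, mul_zero,
    Finset.sum_ite_eq, Finset.mem_univ, if_true]
  rw [Finset.mul_sum]
  exact Finset.sum_congr rfl fun k _ => by ring

lemma polyDiff_sum (c β : ℝ) {n : ℕ} (a : Fin (n + 1) → ℝ) :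
    polyDiff (∑ k : Fin (n + 1), a k • meixnerPoly c k β) =
      ∑ k : Fin (n + 1), (-(c⁻¹ - 1) * ∑ m : Fin (n + 1), if (k : ℕ) < m then a m else 0) •
        meixnerPoly c k β := by
  have h : ∀ m : Fin (n + 1), ∑ k ∈ Finset.range m, meixnerPoly c k β =
      ∑ k : Fin (n + 1), (if (k : ℕ) < m then (1 : ℝ) else 0) • meixnerPoly c k β := fun m => by
    rw [Fin.sum_univ_eq_sum_range
      (fun k => (if k < (m : ℕ) then (1 : ℝ) else 0) • meixnerPoly c k β)]
    simp only [ite_smul, one_smul, zero_smul]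
    rw [← Finset.sum_filter]
    congr 1
    ext k
    simp only [Finset.mem_range, Finset.mem_filter]
    omega
  simp only [map_sum, map_smul, polyDiff_meixnerPoly, h, Finset.smul_sum, smul_smul,
    Finset.mul_sum, Finset.sum_smul]
  rw [Finset.sum_comm]
  refine Finset.sum_congr rfl fun k _ => Finset.sum_congr rfl fun m _ => ?_
  congr 1
  split_ifs <;> ring

/-- The polynomial with coefficients `b`, up to a common factor, with respect to the orthonormal
Meixner polynomials. -/
noncomputable def meixnerExpansion (c β : ℝ) {n : ℕ} (b : Fin (n + 1) → ℝ) : ℝ[X] :=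
  ∑ k : Fin (n + 1), (b k / √(meixnerWeight c⁻¹ β k)) • meixnerPoly c k β

lemma natDegree_meixnerExpansion_le {n : ℕ} (b : Fin (n + 1) → ℝ) :
    (meixnerExpansion c β b).natDegree ≤ n :=
  natDegree_sum_le_of_forall_le _ _ fun k _ =>
    (natDegree_smul_le _ _).trans ((natDegree_meixnerPoly_le c β k).trans (by omega))

lemma exists_eq_meixnerExpansion (hc : 0 < c) (hc1 : c < 1) (hβ : 0 < β) {n : ℕ} {p : ℝ[X]}
    (hp : p.natDegree ≤ n) : ∃ b : Fin (n + 1) → ℝ, p = meixnerExpansion c β b := by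
  obtain ⟨a, ha⟩ := exists_eq_sum_meixnerPoly hc hc1 β n p hp
  refine ⟨fun k => a k * √(meixnerWeight c⁻¹ β k), ?_⟩
  rw [ha, meixnerExpansion, ← Fin.sum_univ_eq_sum_range (fun k => a k • meixnerPoly c k β)]
  refine Finset.sum_congr rfl fun k _ => ?_
  rw [mul_div_cancel_right₀]
  exact (Real.sqrt_pos.2 (meixnerWeight_pos (inv_pos.2 hc) hβ k)).ne'

lemma meixnerNorm_meixnerExpansion_sq (hc : 0 < c) (hc1 : c < 1) (hβ : 0 < β) {n : ℕ}
    (b : Fin (n + 1) → ℝ) :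
    meixnerNorm c β (polySeq (meixnerExpansion c β b)) ^ 2 =
      meixnerFunctional hc hc1 hβ 1 * ∑ k, b k ^ 2 := by
  rw [meixnerNorm_polySeq_sq hc hc1 hβ, meixnerExpansion, meixnerFunctional_sum_mul_self]
  congr 1
  refine Finset.sum_congr rfl fun k _ => ?_
  have h := meixnerWeight_pos (inv_pos.2 hc) hβ k
  rw [div_pow, Real.sq_sqrt h.le, mul_div_cancel₀ _ h.ne']

lemma meixnerNorm_fwdDiff_meixnerExpansion_sq (hc : 0 < c) (hc1 : c < 1) (hβ : 0 < β) {n : ℕ}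
    (b : Fin (n + 1) → ℝ) :
    meixnerNorm c β (fwdDiff 1 (polySeq (meixnerExpansion c β b))) ^ 2 =
      meixnerFunctional hc hc1 hβ 1 * diffForm c β b := by
  rw [fwdDiff_polySeq, meixnerNorm_polySeq_sq hc hc1 hβ, meixnerExpansion, polyDiff_sum,
    meixnerFunctional_sum_mul_self, diffForm]
  congr 1
  refine Finset.sum_congr rfl fun k _ => ?_
  have h := meixnerWeight_pos (inv_pos.2 hc) hβ k
  rw [← Real.sq_sqrt h.le, ← mul_pow, ← neg_sq]
  congr 1
  rw [Finset.mul_sum, Finset.mul_sum, ← Finset.sum_neg_distrib]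
  refine Finset.sum_congr rfl fun m _ => ?_
  by_cases hkm : (k : ℕ) < m
  · rw [diffEntry_of_lt hkm, if_pos hkm, Real.sqrt_div h.le]
    ring
  · rw [diffEntry_of_not_lt hkm, if_neg hkm]
    ring

end Expansion

/-! ### The sharp constant as a matrix norm, and its monotonicity in `β`. -/

section MarkovConst

variable {c β : ℝ}

/-- The factor `H = ‖1‖²` occurs in both squared norms and cancels, leaving the maximum of
`diffForm` on the unit sphere. -/
lemma exists_meixnerExpansion_eq (hc : 0 < c) (hc1 : c < 1) (hβ : 0 < β) (n : ℕ) :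
    ∃ b : Fin (n + 1) → ℝ, (∀ k, 0 ≤ b k) ∧ ∑ k, b k ^ 2 = 1 ∧
      diffForm c β b = markovConst n c β ^ 2 ∧
      IsGreatest {r : ℝ | ∃ p : ℝ[X], p.natDegree ≤ n ∧ meixnerNorm c β (polySeq p) = 1 ∧
        r = meixnerNorm c β (fwdDiff 1 (polySeq p))} (markovConst n c β) ∧
      ∀ a : Fin (n + 1) → ℝ, diffForm c β a ≤ markovConst n c β ^ 2 * ∑ k, a k ^ 2 := by
  obtain ⟨b, hb0, hb1, hmax⟩ := exists_nonneg_forall_diffForm_le hc hc1 β n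
  set H := meixnerFunctional hc hc1 hβ 1 with hH
  have hHpos : 0 < H := meixnerFunctional_one_pos hc hc1 hβ
  have hHs : H * (√H)⁻¹ ^ 2 = 1 := by
    rw [inv_pow, Real.sq_sqrt hHpos.le, mul_inv_cancel₀ hHpos.ne']
  have hgreatest : IsGreatest {r : ℝ | ∃ p : ℝ[X], p.natDegree ≤ n ∧
      meixnerNorm c β (polySeq p) = 1 ∧ r = meixnerNorm c β (fwdDiff 1 (polySeq p))}
      (√(diffForm c β b)) := by
    refine ⟨⟨meixnerExpansion c β ((√H)⁻¹ • b), natDegree_meixnerExpansion_le _, ?_, ?_⟩, ?_⟩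
    · rw [← pow_left_inj₀ (meixnerNorm_nonneg _ _ _) zero_le_one two_ne_zero,
        meixnerNorm_meixnerExpansion_sq hc hc1 hβ]
      simp only [Pi.smul_apply, smul_eq_mul, mul_pow, ← Finset.mul_sum, hb1]
      rw [mul_one, hHs, one_pow]
    · rw [← pow_left_inj₀ (Real.sqrt_nonneg _) (meixnerNorm_nonneg _ _ _) two_ne_zero,
        meixnerNorm_fwdDiff_meixnerExpansion_sq hc hc1 hβ, diffForm_smul,
        ← mul_assoc, hHs, one_mul, Real.sq_sqrt (diffForm_nonneg b)]
    · rintro r ⟨p, hp, hp1, rfl⟩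
      obtain ⟨a, rfl⟩ := exists_eq_meixnerExpansion hc hc1 hβ hp
      have h1 := meixnerNorm_meixnerExpansion_sq hc hc1 hβ a
      rw [hp1, one_pow] at h1
      refine Real.le_sqrt_of_sq_le ?_
      rw [meixnerNorm_fwdDiff_meixnerExpansion_sq hc hc1 hβ]
      refine (mul_le_mul_of_nonneg_left (hmax a) hHpos.le).trans_eq ?_
      rw [mul_left_comm, ← h1, mul_one]
  have hγ : markovConst n c β = √(diffForm c β b) := hgreatest.csSup_eq
  have hγ2 : diffForm c β b = markovConst n c β ^ 2 := by
    rw [hγ, Real.sq_sqrt (diffForm_nonneg b)]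
  refine ⟨b, hb0, hb1, hγ2, ?_, fun a => ?_⟩
  · rw [hγ]; exact hgreatest
  · rw [← hγ2]; exact hmax a

lemma markovConst_nonneg (n : ℕ) (c β : ℝ) : 0 ≤ markovConst n c β := by
  refine Real.sSup_nonneg ?_
  rintro r ⟨p, -, -, rfl⟩
  exact Real.sqrt_nonneg _

lemma isLeast_markovConst (hc : 0 < c) (hc1 : c < 1) (hβ : 0 < β) (n : ℕ) :
    IsLeast {C : ℝ | ∀ p : ℝ[X], p.natDegree ≤ n →
      meixnerNorm c β (fwdDiff 1 (polySeq p)) ≤ C * meixnerNorm c β (polySeq p)}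
      (markovConst n c β) := by
  obtain ⟨-, -, -, -, hgreatest, hle⟩ := exists_meixnerExpansion_eq hc hc1 hβ n
  refine ⟨fun p hp => ?_, fun C hC => ?_⟩
  · obtain ⟨a, rfl⟩ := exists_eq_meixnerExpansion hc hc1 hβ hp
    refine (sq_le_sq₀ (meixnerNorm_nonneg _ _ _)
      (mul_nonneg (markovConst_nonneg n c β) (meixnerNorm_nonneg _ _ _))).1 ?_
    rw [mul_pow, meixnerNorm_fwdDiff_meixnerExpansion_sq hc hc1 hβ,
      meixnerNorm_meixnerExpansion_sq hc hc1 hβ, mul_left_comm]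
    exact mul_le_mul_of_nonneg_left (hle a) (meixnerFunctional_one_pos hc hc1 hβ).le
  · obtain ⟨p, hp, hp1, hpe⟩ := hgreatest.1
    have := hC p hp
    rwa [hp1, mul_one, ← hpe] at this

lemma markovConst_strictAntiOn (hc : 0 < c) (hc1 : c < 1) {n : ℕ} (hn : 1 ≤ n) :
    StrictAntiOn (fun β : ℝ => markovConst n c β) (Set.Ioi 0) := by
  intro β₁ h₁ β₂ h₂ h₁₂
  obtain ⟨b, hb0, hb1, hb, -, hle⟩ := exists_meixnerExpansion_eq hc hc1 h₂ n
  obtain ⟨-, -, -, -, -, hle₁⟩ := exists_meixnerExpansion_eq hc hc1 h₁ n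
  have hrow : ∀ k : Fin (n + 1), 0 ≤ ∑ m : Fin (n + 1), diffEntry c β₂ k m * b m := fun k =>
    Finset.sum_nonneg fun m _ => mul_nonneg (diffEntry_nonneg hc hc1 _ _) (hb0 m)
  -- The extremal vector for `β₂` will be tested at `β₁`. Strictness in row `0` needs a positive
  -- coordinate off the constants. Otherwise the maximum would be `0`, yet the last basis vector
  -- gives a positive value because `n ≥ 1`.
  have hexists : ∃ m : Fin (n + 1), (0 : ℕ) < m ∧ 0 < b m := by
    by_contra! hcon
    have hzero : diffForm c β₂ b = 0 := by
      refine Finset.sum_eq_zero fun k _ => ?_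
      rw [pow_eq_zero_iff two_ne_zero]
      refine Finset.sum_eq_zero fun m _ => ?_
      by_cases hm : (0 : ℕ) < m
      · rw [le_antisymm (hcon m hm) (hb0 m), mul_zero]
      · rw [diffEntry_of_not_lt (by omega), zero_mul]
    have h := hle (Pi.single (Fin.last n) 1)
    rw [← hb, hzero, zero_mul] at h
    have hpos : 0 < diffForm c β₂ (Pi.single (Fin.last n) 1) := by
      refine Finset.sum_pos' (fun _ _ => sq_nonneg _) ⟨0, Finset.mem_univ _, ?_⟩
      have h0 : 0 < diffEntry c β₂ 0 n := diffEntry_pos hc hc1 h₂ (by omega)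
      simp [Pi.single_apply, h0]
    exact h.not_gt hpos
  obtain ⟨m₀, hm₀, hbm₀⟩ := hexists
  have hlt : diffForm c β₂ b < diffForm c β₁ b := by
    refine Finset.sum_lt_sum (fun k _ => ?_) ⟨0, Finset.mem_univ _, ?_⟩
    · refine pow_le_pow_left₀ (hrow k) (Finset.sum_le_sum fun m _ => ?_) 2
      exact mul_le_mul_of_nonneg_right (diffEntry_anti hc hc1 h₁ h₁₂ _ _) (hb0 m)
    · refine pow_lt_pow_left₀ (Finset.sum_lt_sum (fun m _ => ?_) ⟨m₀, Finset.mem_univ _, ?_⟩)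
        (hrow 0) two_ne_zero
      · exact mul_le_mul_of_nonneg_right (diffEntry_anti hc hc1 h₁ h₁₂ _ _) (hb0 m)
      · exact mul_lt_mul_of_pos_right (diffEntry_strictAnti hc hc1 h₁ h₁₂ (by simpa using hm₀)) hbm₀
  have h := hle₁ b
  rw [hb1, mul_one] at h
  exact lt_of_pow_lt_pow_left₀ 2 (markovConst_nonneg n c β₁) (hb ▸ hlt.trans_le h)

end MarkovConst

/-! ### Upper bounds from the shift operator. -/

section UpperBound

variable {c β : ℝ}

lemma tsum_meixnerWeight_succ_mul_eval (hc : 0 < c) (hc1 : c < 1) (hβ : 0 < β) (p : ℝ[X]) :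
    ∑' k : ℕ, meixnerWeight c β (k + 1) * ((p.comp (X + 1)) * p.comp (X + 1)).eval (k : ℝ) =
      meixnerFunctional hc hc1 hβ (p * p) - p.eval 0 ^ 2 := by
  rw [meixnerFunctional_apply,
    (summable_meixnerWeight_mul_eval hc hc1 hβ (p * p)).tsum_eq_zero_add]
  simp [meixnerWeight_zero, pow_two]

lemma meixnerFunctional_shift_mul_self_le (hc : 0 < c) (hc1 : c < 1) (hβ : 0 < β) (p : ℝ[X]) :
    meixnerFunctional hc hc1 hβ (p.comp (X + 1) * p.comp (X + 1)) ≤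
      (1 + β⁻¹) / c * meixnerFunctional hc hc1 hβ (p * p) := by
  -- The constant works because `(1 + β⁻¹)(β + k) - (k + 1) = β + k β⁻¹ ≥ 0`.
  have hW : ∀ k, meixnerWeight c β k ≤ (1 + β⁻¹) / c * meixnerWeight c β (k + 1) := fun k => by
    have h : (1 + β⁻¹) / c * meixnerWeight c β (k + 1) - meixnerWeight c β k =
        meixnerWeight c β k * ((β + k * β⁻¹) / (k + 1)) := by
      rw [meixnerWeight_succ]
      field_simp
      ring
    have h' : 0 ≤ meixnerWeight c β k * ((β + k * β⁻¹) / (k + 1)) :=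
      mul_nonneg (meixnerWeight_pos hc hβ k).le (by positivity)
    linarith
  have hs := (summable_nat_add_iff 1).2 (summable_meixnerWeight_mul_eval hc hc1 hβ (p * p))
  have hs' : Summable fun k : ℕ =>
      meixnerWeight c β (k + 1) * (p.comp (X + 1) * p.comp (X + 1)).eval (k : ℝ) := by
    simpa using hs
  have h1 : meixnerFunctional hc hc1 hβ (p.comp (X + 1) * p.comp (X + 1)) ≤
      (1 + β⁻¹) / c * ∑' k : ℕ,
        meixnerWeight c β (k + 1) * (p.comp (X + 1) * p.comp (X + 1)).eval (k : ℝ) := by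
    rw [meixnerFunctional_apply, ← tsum_mul_left]
    refine (summable_meixnerWeight_mul_eval hc hc1 hβ _).tsum_le_tsum (fun k => ?_)
      (hs'.mul_left _)
    rw [← mul_assoc]
    refine mul_le_mul_of_nonneg_right (hW k) ?_
    rw [eval_mul]
    exact mul_self_nonneg _
  rw [tsum_meixnerWeight_succ_mul_eval hc hc1 hβ] at h1
  refine h1.trans (mul_le_mul_of_nonneg_left ?_ (by positivity))
  linarith [sq_nonneg (p.eval 0)]

lemma exists_forall_markovConst_le (hc : 0 < c) (hc1 : c < 1) (hβ : 0 < β) :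
    ∃ C : ℝ, 0 < C ∧ ∀ n : ℕ, markovConst n c β ≤ C := by
  have hpos : 0 < 2 * ((1 + β⁻¹) / c) + 2 := by positivity
  refine ⟨√(2 * ((1 + β⁻¹) / c) + 2), Real.sqrt_pos.2 hpos, fun n => ?_⟩
  refine (isLeast_markovConst hc hc1 hβ n).2 fun p _ => ?_
  rw [← sq_le_sq₀ (meixnerNorm_nonneg _ _ _)
    (mul_nonneg (Real.sqrt_nonneg _) (meixnerNorm_nonneg _ _ _)), mul_pow, Real.sq_sqrt hpos.le,
    fwdDiff_polySeq, meixnerNorm_polySeq_sq hc hc1 hβ, meixnerNorm_polySeq_sq hc hc1 hβ]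
  have h1 : polyDiff p * polyDiff p = (2 : ℝ) • (p.comp (X + 1) * p.comp (X + 1)) +
      (2 : ℝ) • (p * p) - (p.comp (X + 1) + p) * (p.comp (X + 1) + p) := by
    simp only [polyDiff_apply, smul_eq_C_mul, C_ofNat]
    ring
  have h2 := meixnerFunctional_mul_self_nonneg hc hc1 hβ (p.comp (X + 1) + p)
  have h3 := meixnerFunctional_shift_mul_self_le hc hc1 hβ p
  rw [h1, map_sub, map_add, map_smul, map_smul, smul_eq_mul, smul_eq_mul]
  linarith

lemma eval_natCast_eq_zero_of_meixnerFunctional_eq_zero (hc : 0 < c) (hc1 : c < 1) (hβ : 0 < β)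
    {q : ℝ[X]} (h : meixnerFunctional hc hc1 hβ (q * q) = 0) (k : ℕ) : q.eval (k : ℝ) = 0 := by
  have hsum := (summable_meixnerWeight_mul_eval hc hc1 hβ (q * q)).hasSum
  rw [← meixnerFunctional_apply hc hc1 hβ, h, hasSum_zero_iff_of_nonneg] at hsum
  · have := congrFun hsum k
    simpa [(meixnerWeight_pos hc hβ k).ne'] using this
  · intro k
    refine mul_nonneg (meixnerWeight_pos hc hβ k).le ?_
    rw [eval_mul]
    exact mul_self_nonneg _

lemma meixnerFunctional_one_shift_mul_self (hc : 0 < c) (hc1 : c < 1) (p : ℝ[X]) :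
    c * meixnerFunctional hc hc1 one_pos (p.comp (X + 1) * p.comp (X + 1)) =
      meixnerFunctional hc hc1 one_pos (p * p) - p.eval 0 ^ 2 := by
  rw [← tsum_meixnerWeight_succ_mul_eval hc hc1 one_pos, meixnerFunctional_apply, ← tsum_mul_left]
  refine tsum_congr fun k => ?_
  rw [meixnerWeight_one, meixnerWeight_one, pow_succ']
  ring

/-- With `a = p(· + 1)` and `s = √c`, use `(a - p)² = (1 + s) a² + (1 + s⁻¹) p² - s⁻¹ (s a + p)²`.
As `s² ‖a‖² = ‖p‖² - p(0)²`, the deficit from `(1 + 1/s)² ‖p‖²` is an explicit sum of squares. -/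
lemma meixnerFunctional_one_polyDiff_lt (hc : 0 < c) (hc1 : c < 1) {p : ℝ[X]}
    (hp : 0 < meixnerFunctional hc hc1 one_pos (p * p)) :
    meixnerFunctional hc hc1 one_pos (polyDiff p * polyDiff p) <
      (1 + 1 / √c) ^ 2 * meixnerFunctional hc hc1 one_pos (p * p) := by
  set s := √c with hs
  have hspos : 0 < s := Real.sqrt_pos.2 hc
  have hs2 : c = s ^ 2 := (Real.sq_sqrt hc.le).symm
  set q := s • p.comp (X + 1) + p with hq
  have hdecomp : polyDiff p * polyDiff p = (1 + s) • (p.comp (X + 1) * p.comp (X + 1)) +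
      (1 + s⁻¹) • (p * p) - s⁻¹ • (q * q) := by
    have hC : C s * C s⁻¹ = (1 : ℝ[X]) := by rw [← C_mul, mul_inv_cancel₀ hspos.ne', C_1]
    simp only [hq, polyDiff_apply, smul_eq_C_mul, C_add, C_1]
    linear_combination
      (C s * p.comp (X + 1) * p.comp (X + 1) + 2 * p.comp (X + 1) * p) * hC
  have hshift := meixnerFunctional_one_shift_mul_self hc hc1 p
  set A := meixnerFunctional hc hc1 one_pos (p.comp (X + 1) * p.comp (X + 1))
  set B := meixnerFunctional hc hc1 one_pos (p * p) with hB
  set D := meixnerFunctional hc hc1 one_pos (q * q) with hD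
  have hD0 : 0 ≤ D := meixnerFunctional_mul_self_nonneg hc hc1 one_pos q
  have hA : A = (B - p.eval 0 ^ 2) / s ^ 2 := by
    rw [eq_div_iff (by positivity), mul_comm, ← hs2, hshift]
  have hval : (1 + 1 / s) ^ 2 * B -
      meixnerFunctional hc hc1 one_pos (polyDiff p * polyDiff p) =
      (1 + s) / s ^ 2 * p.eval 0 ^ 2 + s⁻¹ * D := by
    rw [hdecomp, map_sub, map_add, map_smul, map_smul, map_smul]
    change _ - ((1 + s) * A + (1 + s⁻¹) * B - s⁻¹ * D) = _
    rw [hA]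
    field_simp
    ring
  have hpos : 0 < (1 + s) / s ^ 2 * p.eval 0 ^ 2 + s⁻¹ * D := by
    by_contra! hcon
    have h1 : 0 ≤ (1 + s) / s ^ 2 * p.eval 0 ^ 2 := by positivity
    have h2 : 0 ≤ s⁻¹ * D := by positivity
    have h3 : p.eval 0 = 0 := by
      have : (1 + s) / s ^ 2 * p.eval 0 ^ 2 = 0 := by linarith
      have h4 : (1 + s) / s ^ 2 ≠ 0 := by positivity
      simpa [h4] using this
    have h5 : D = 0 := by
      have : s⁻¹ * D = 0 := by linarith
      simpa [hspos.ne'] using this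
    -- Zero deficit means `p(0) = 0` and `√c p(k + 1) = -p(k)` for all `k`.
    have h6 : ∀ k : ℕ, p.eval (k : ℝ) = 0 := fun k => by
      induction k with
      | zero => simpa using h3
      | succ k ih =>
        have := eval_natCast_eq_zero_of_meixnerFunctional_eq_zero hc hc1 one_pos h5 k
        simpa [hq, ih, hspos.ne'] using this
    refine hp.ne' ?_
    rw [hB, meixnerFunctional_apply]
    simp [h6]
  linarith

lemma markovConst_one_lt (hc : 0 < c) (hc1 : c < 1) (n : ℕ) :
    markovConst n c 1 < 1 + 1 / √c := by
  obtain ⟨-, -, -, -, ⟨⟨p, -, hp1, hp⟩, -⟩, -⟩ := exists_meixnerExpansion_eq hc hc1 one_pos n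
  have hsq := meixnerNorm_polySeq_sq hc hc1 one_pos p
  rw [hp1, one_pow] at hsq
  have h := meixnerFunctional_one_polyDiff_lt hc hc1 (p := p) (by rw [← hsq]; exact one_pos)
  rw [← hsq, mul_one, ← meixnerNorm_polySeq_sq hc hc1 one_pos, ← fwdDiff_polySeq, ← hp] at h
  exact lt_of_pow_lt_pow_left₀ 2 (by positivity) h

end UpperBound

/-! ### The limit for `β = 1`. -/

section Limit

variable {c : ℝ}

lemma diffEntry_one_add_succ (hc : 0 < c) (k i : ℕ) :
    diffEntry c 1 k (k + i + 1) = (c⁻¹ - 1) * √c ^ (i + 1) := by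
  rw [diffEntry_of_lt (by omega), meixnerWeight_one, meixnerWeight_one]
  congr 1
  have h : c⁻¹ ^ k / c⁻¹ ^ (k + i + 1) = (√c ^ (i + 1)) ^ 2 := by
    rw [← pow_mul, mul_comm (i + 1), pow_mul, Real.sq_sqrt hc.le, add_assoc, pow_add]
    field_simp
    rw [← mul_pow, one_div_mul_cancel hc.ne', one_pow]
  rw [h, Real.sqrt_sq (by positivity)]

lemma sum_diffEntry_one (hc : 0 < c) (k i : ℕ) :
    ∑ m ∈ Finset.range (k + i + 1), diffEntry c 1 k m =
      (c⁻¹ - 1) * ∑ j ∈ Finset.range i, √c ^ (j + 1) := by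
  induction i with
  | zero =>
    simp only [Finset.range_zero, Finset.sum_empty, mul_zero]
    refine Finset.sum_eq_zero fun m hm => diffEntry_of_not_lt ?_
    rw [Finset.mem_range] at hm
    omega
  | succ i ih =>
    rw [← add_assoc, Finset.sum_range_succ, ih, diffEntry_one_add_succ hc, Finset.sum_range_succ,
      mul_add]

lemma diffForm_one_one (hc : 0 < c) (n : ℕ) :
    diffForm c 1 (fun _ : Fin (n + 1) => (1 : ℝ)) =
      ∑ i ∈ Finset.range (n + 1), ((c⁻¹ - 1) * ∑ j ∈ Finset.range i, √c ^ (j + 1)) ^ 2 := by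
  simp only [diffForm, mul_one]
  -- Row `k` has `n - k` nonzero entries, so the rows are counted backwards with `i = n - k`.
  rw [← Finset.sum_range_reflect, Finset.sum_range]
  refine Finset.sum_congr rfl fun k _ => ?_
  rw [← sum_diffEntry_one hc k, Finset.sum_range]
  have : (k : ℕ) + (n + 1 - 1 - k) = n := by omega
  rw [this]

lemma tendsto_sum_sqrt_pow (hc : 0 < c) (hc1 : c < 1) :
    Tendsto (fun i : ℕ => (c⁻¹ - 1) * ∑ j ∈ Finset.range i, √c ^ (j + 1)) atTop
      (𝓝 (1 + 1 / √c)) := by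
  have hspos : 0 < √c := Real.sqrt_pos.2 hc
  have hs1 : √c < 1 := by rw [Real.sqrt_lt' one_pos]; simpa using hc1
  have h := ((hasSum_geometric_of_lt_one hspos.le hs1).mul_left √c).tendsto_sum_nat.const_mul
    (c⁻¹ - 1)
  have hval : (c⁻¹ - 1) * (√c * (1 - √c)⁻¹) = 1 + 1 / √c := by
    have h1 : 1 - √c ≠ 0 := by linarith
    nth_rw 1 [← Real.sq_sqrt hc.le]
    field_simp
    ring
  rw [hval] at h
  simpa only [pow_succ'] using h

lemma tendsto_markovConst_one (hc : 0 < c) (hc1 : c < 1) :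
    Tendsto (fun n : ℕ => markovConst n c 1) atTop (𝓝 (1 + 1 / √c)) := by
  -- The all-ones vector has squared length `n + 1`, so `γ_n²` is at least the mean of the `n + 1`
  -- squared row sums, a Cesàro mean.
  have hces := ((tendsto_sum_sqrt_pow hc hc1).pow 2).cesaro.comp (tendsto_add_atTop_nat 1)
  have hlow := (Real.continuous_sqrt.tendsto _).comp hces
  have h0 : (0 : ℝ) ≤ 1 + 1 / √c := by positivity
  rw [Real.sqrt_sq h0] at hlow
  refine tendsto_of_tendsto_of_tendsto_of_le_of_le hlow tendsto_const_nhds (fun n => ?_)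
    fun n => (markovConst_one_lt hc hc1 n).le
  refine Real.sqrt_le_iff.2 ⟨markovConst_nonneg n c 1, ?_⟩
  obtain ⟨-, -, -, -, -, hle⟩ := exists_meixnerExpansion_eq hc hc1 one_pos n
  have h := hle fun _ => 1
  rw [diffForm_one_one hc] at h
  have hn : (0 : ℝ) < ((n + 1 : ℕ) : ℝ) := by positivity
  simp only [Function.comp_apply]
  rw [inv_mul_le_iff₀ hn, mul_comm]
  simpa using h

end Limit

theorem theorem1p1 :
    -- The series defining the inner product of polynomials converge, and `markovConst n c β`
    -- really is the smallest admissible constant.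
    (∀ c β : ℝ, 0 < c → c < 1 → 0 < β →
      (∀ p q : Polynomial ℝ,
        Summable (fun k : ℕ => meixnerWeight c β k * polySeq p k * polySeq q k)) ∧
      ∀ n : ℕ, IsLeast {C : ℝ | ∀ p : Polynomial ℝ, p.natDegree ≤ n →
        meixnerNorm c β (fwdDiff 1 (polySeq p)) ≤ C * meixnerNorm c β (polySeq p)}
        (markovConst n c β)) ∧
    -- (i)
    (∀ c : ℝ, 0 < c → c < 1 →
      (∀ n : ℕ, markovConst n c 1 < 1 + 1 / Real.sqrt c) ∧
      Tendsto (fun n : ℕ => markovConst n c 1) atTop (𝓝 (1 + 1 / Real.sqrt c))) ∧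
    -- (ii)
    (∀ n : ℕ, 1 ≤ n → ∀ c : ℝ, 0 < c → c < 1 →
      StrictAntiOn (fun β : ℝ => markovConst n c β) (Set.Ioi 0)) ∧
    -- (iii)
    (∀ c β : ℝ, 0 < c → c < 1 → 0 < β →
      ∃ C : ℝ, 0 < C ∧ ∀ n : ℕ, markovConst n c β ≤ C) := by
  refine ⟨fun c β hc hc1 hβ => ⟨fun p q => ?_, isLeast_markovConst hc hc1 hβ⟩,
    fun c hc hc1 => ⟨markovConst_one_lt hc hc1, tendsto_markovConst_one hc hc1⟩,
    fun n hn c hc hc1 => markovConst_strictAntiOn hc hc1 hn,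
    fun c β hc hc1 hβ => exists_forall_markovConst_le hc hc1 hβ⟩
  simpa [polySeq, mul_assoc] using summable_meixnerWeight_mul_eval hc hc1 hβ (p * q)
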